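/- Let $m,n\ge 1$ be coprime integers and let the level of $(i,j)\in\mathbb Z\times\mathbb Z$ be $\ell(i,j)=im+jn$. An $(m,n)$-filter is a nonempty proper subset $\mathfrak i\subset\mathbb Z\times\mathbb Z$ that is an order filter (an up-set for the componentwise order) and contains, with each point, all points of the same level. Its $m$-set $m(\mathfrak i)$ is the set of the $m$ integers $\min\{\ell(i,j):i\in\mathbb Z,\ (i,j)\in\mathfrak i\}$, $j\in\mathbb Z$. A parking $(m,n)$-filter tuple is a tuple $\mathfrak p=(\mathfrak p^{(0)},\dots,\mathfrak p^{(n)})$ of $(m,n)$-filters such that (i) for $0\le i<n$ there is $p_i\in m(\mathfrak p^{(i)})$ with $m(\mathfrak p^{(i+1)})=(m(\mathfrak p^{(i)})\setminus\{p_i\})\cup\{p_i+m\}$ (the level $p_i$ is removed in step $i$); (ii) $m(\mathfrak p^{(0)})+n=m(\mathfrak p^{(n)})$; (iii) the minimum of the levels of the points of $\mathfrak p^{(0)}$ is $0$. Write $\mathcal{PT}_m^n$ for the set of these tuples. An $(m,n)$-parking word is a word $w=w_0\cdots w_{n-1}\in\{0,\dots,m-1\}^n$ with $|\{j:w_j<i\}|\ge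 in/m$ for $1\le i\le m$. Write $\mathcal{PW}_m^n$ for the set of these words. For $\mathfrak p\in\mathcal{PT}_m^n$ let $B(\mathfrak p)$ be the word whose $i$-th letter ($0\le i<n$) is the relative rank of $p_i$ in $m(\mathfrak p^{(i)})$, that is $B(\mathfrak p)_i=|\{l\in m(\mathfrak p^{(i)}):l<p_i\}|$. Let $A(\mathfrak p)$ be the word of column lengths of the labelled lattice path of $\mathfrak p$: the boundary of $\mathfrak p^{(0)}$ from $(0,0)$ to $(-n,m)$ has, for each $x$ with $-n\le x<0$, one horizontal step, with left endpoint $(x,y)$ where $y=\min\{j:(x,j)\in\mathfrak p^{(0)}\}$; if $\ell(x,y)=p_i$, that step has label $i$, and $A(\mathfrak p)_i=m-y$. Theorem. The map $B$ is a bijection from $\mathcal{PT}_m^n$ onto $\mathcal{PW}_m^n$. The map $A$ is also a bijection from $\mathcal{PT}_m^n$ onto $\mathcal{PW}_m^n$, and hence the rational zeta map $\zeta=B\circ A^{-1}$ is a bijection from $\mathcal{PW}_m^n$ onto itself. -/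

import Mathlib

namespace RationalZeta

/-- The level of a lattice point: its dot product with `(m, n)`. -/
def level (m n : ℕ) (a : ℤ × ℤ) : ℤ := a.1 * m + a.2 * n

/-- An `(m, n)`-filter: an order filter of `ℤ × ℤ` (componentwise order) that contains, with a point,
all points of the same level.  The two trivial order filters `∅` and `ℤ × ℤ` are not allowed, so that
every row and every column has a lowest level. -/
@[ext]
structure MNFilter (m n : ℕ) where
  carrier : Set (ℤ × ℤ)
  isUpperSet : IsUpperSet carrier
  level_closed : ∀ a ∈ carrier, ∀ b, level m n b = level m n a → b ∈ carrier
  nonempty : carrier.Nonempty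
  ne_univ : carrier ≠ Set.univ

/-- The `m`-set of a filter: for every row `j`, the least level of a point of that row that lies in
the filter. -/
def MNFilter.mSet {m n : ℕ} (F : MNFilter m n) : Set ℤ :=
  {l | ∃ j : ℤ, IsLeast {t | ∃ i : ℤ, (i, j) ∈ F.carrier ∧ t = level m n (i, j)} l}

/-- A Dyck `(m, n)`-filter: the minimum of its levels is `0`. -/
def MNFilter.IsDyck {m n : ℕ} (F : MNFilter m n) : Prop :=
  IsLeast (level m n '' F.carrier) 0

/-- An `(m, n)`-filter tuple: `n + 1` filters, the `m`-set of each of which arises from that of the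
previous one by replacing one element `p` by `p + m`, the last `m`-set being the first one
shifted by `n`. -/
@[ext]
structure FilterTuple (m n : ℕ) where
  filt : Fin (n + 1) → MNFilter m n
  step : ∀ i : Fin n, ∃ p ∈ (filt i.castSucc).mSet,
    (filt i.succ).mSet = ((filt i.castSucc).mSet \ {p}) ∪ {p + (m : ℤ)}
  cyclic : (fun l : ℤ => l + n) '' (filt 0).mSet = (filt (Fin.last n)).mSet

/-- The level removed in step `i` of a filter tuple (it is unique, see `removed_unique`). -/
noncomputable def FilterTuple.removed {m n : ℕ} (P : FilterTuple m n) (i : Fin n) : ℤ :=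
  (P.step i).choose

theorem FilterTuple.removed_unique {m n : ℕ} (hm : 0 < m) (P : FilterTuple m n) (i : Fin n) (p : ℤ)
    (hp : p ∈ (P.filt i.castSucc).mSet)
    (h : (P.filt i.succ).mSet = ((P.filt i.castSucc).mSet \ {p}) ∪ {p + (m : ℤ)}) :
    p = P.removed i := by
  have hq := (P.step i).choose_spec.2
  change (P.filt i.succ).mSet = (_ \ {P.removed i}) ∪ {P.removed i + (m : ℤ)} at hq
  by_contra hne
  have h1 : p ∈ (P.filt i.succ).mSet := by
    rw [hq]; exact Or.inl ⟨hp, hne⟩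
  rw [h] at h1
  rcases h1 with h1 | h1
  · exact h1.2 rfl
  · have : p = p + (m : ℤ) := h1
    omega

/-- The parking `(m, n)`-filter tuples: those whose first filter is a Dyck filter. -/
def parkingTuples (m n : ℕ) : Set (FilterTuple m n) := {P | (P.filt 0).IsDyck}

/-- The `(m, n)`-parking words: the words of length `n` in the letters `0, …, m - 1` that have, for
every `1 ≤ i ≤ m`, at least `i * n / m` letters smaller than `i`. -/
def parkingWords (m n : ℕ) : Set (Fin n → ℕ) :=
  {w | (∀ j, w j < m) ∧ ∀ i : ℕ, 1 ≤ i → i ≤ m →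
    ((i : ℚ) * n) / m ≤ ((Finset.univ.filter fun j => w j < i).card : ℚ)}

/-- `(x, y)` is the left endpoint of a horizontal (west) step of the boundary path of the filter `F`
inside the strip `-n ≤ x ≤ 0`.  For a Dyck filter this boundary path is the associated Dyck path from
`(0, 0)` to `(-n, m)`; its horizontal step in column `x` joins `(x + 1, y)` to `(x, y)`, where
`(x, y)` is the lowest point of the filter on the vertical line through `x`. -/
def MNFilter.IsStepEndpoint {m n : ℕ} (F : MNFilter m n) (x y : ℤ) : Prop :=
  -(n : ℤ) ≤ x ∧ x < 0 ∧ IsLeast {j : ℤ | (x, j) ∈ F.carrier} y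

/-- The map `A`.  The horizontal step of the path of the first filter with label `i` is the one whose
left endpoint `(x, y)` is removed in step `i`; `A` records the length of its column, that is the
number of unit boxes `[j, j + 1]` between the height `y` of the step and the top `m` of the
`m × n` rectangle. -/
noncomputable def mapA {m n : ℕ} (P : FilterTuple m n) (i : Fin n) : ℕ :=
  Set.ncard {j : ℤ | ∃ x y : ℤ, (P.filt 0).IsStepEndpoint x y ∧ level m n (x, y) = P.removed i ∧
    y ≤ j ∧ j < m}

/-- The map `B`: the relative rank (counted from `0`) of the level removed in step `i` within the
`m`-set from which it is removed. -/
noncomputable def mapB {m n : ℕ} (P : FilterTuple m n) (i : Fin n) : ℕ :=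
  Set.ncard {l : ℤ | l ∈ (P.filt i.castSucc).mSet ∧ l < P.removed i}

open Classical in
/-- The rational zeta map `B ∘ A⁻¹` (on words that are not in the image of the parking tuples
under `A`, its value is irrelevant). -/
noncomputable def zeta (m n : ℕ) (w : Fin n → ℕ) : Fin n → ℕ :=
  if h : ∃ P ∈ parkingTuples m n, mapA P = w then mapB h.choose else w

end RationalZeta

namespace RationalZeta

/-! A filter amounts to its set of levels, which is closed under adding `m` and `n`. A tuple removes
`n` levels one by one until this set has moved by `n`, so the removed levels are the elements `l` of
the first level set with `l - n` outside it, one in each class mod `n`.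

For `A`, write a removed level as `t * m - a * n` with column `t` and column length `a`. Closure
under `m` makes `a` weakly increasing in `t`, and within a run of equal lengths the removals go from
left to right; hence `t` is the position of the label in the stable sort of the word (`removed_eq`).
Nonnegativity of the levels is the parking condition, and `pathTuple` reverses the construction.

For `B`, the sorted `m`-sets form an orbit of vectors: add `m` to the entry of index `B_i`, then
sort. The growth of the sum of the `i` smallest entries gives the parking condition
(`mul_le_card_mul`). For injectivity, compare two orbits of one word: sorting never increases their
Euclidean distance, yet it ends as it began, so both are sorted by the same permutations
(`exists_common_perm`). Following residues mod `m`, coprimality makes their difference constant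
(`sub_eq_sub`), and the Dyck condition makes it zero. Surjectivity of `B` follows by counting from
the bijectivity of `A`. -/

variable {m n : ℕ}

/-! ### Arithmetic of levels and of translation-closed sets of integers. -/

theorem level_surjective (hmn : Nat.Coprime m n) (z : ℤ) : ∃ a, level m n a = z := by
  obtain ⟨u, v, h⟩ := Nat.isCoprime_iff_coprime.2 hmn
  refine ⟨(z * u, z * v), ?_⟩
  simp only [level]
  linear_combination z * h

/-- The two coordinates of a level are determined by it once the first one is confined to an
interval of length `n`. -/
theorem level_coords_unique (hn : 0 < n) (hmn : Nat.Coprime m n) {x y x' y' : ℤ}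
    (h : x * m + y * n = x' * m + y' * n) (h1 : x - x' < n) (h2 : x' - x < n) :
    x = x' ∧ y = y' := by
  have hd : (n : ℤ) ∣ (x - x') * m := ⟨y' - y, by linear_combination h⟩
  have hd' : (n : ℤ) ∣ x - x' :=
    (Nat.isCoprime_iff_coprime.2 hmn.symm).dvd_of_dvd_mul_right hd
  have hx : x - x' = 0 := Int.eq_zero_of_abs_lt_dvd hd' (by rw [abs_lt]; constructor <;> linarith)
  have hx' : x = x' := by linarith
  subst hx'
  have hn' : (n : ℤ) ≠ 0 := by exact_mod_cast hn.ne'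
  exact ⟨rfl, mul_right_cancel₀ hn' (by linarith)⟩

/-- Every integer is `t * m - a * n` with `0 ≤ t < n`. -/
theorem exists_coords (hn : 0 < n) (hmn : Nat.Coprime m n) (z : ℤ) :
    ∃ (t : Fin n) (a : ℤ), z = (t : ℕ) * m - a * n := by
  obtain ⟨⟨x, y⟩, h⟩ := level_surjective hmn z
  have hn' : (0 : ℤ) < n := by exact_mod_cast hn
  have h0 := Int.emod_nonneg x hn'.ne'
  have h1 := Int.emod_lt_of_pos x hn'
  refine ⟨⟨(x % n).toNat, by omega⟩, -y - x / n * m, ?_⟩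
  have h2 : (((x % n).toNat : ℕ) : ℤ) = x % n := Int.toNat_of_nonneg h0
  have h3 := Int.emod_add_mul_ediv x n
  simp only [level] at h
  rw [← h]
  simp only [h2]
  linear_combination -(m : ℤ) * h3

theorem add_natCast_mul_mem {S : Set ℤ} {d : ℤ} (hS : ∀ l ∈ S, l + d ∈ S) {l : ℤ} (hl : l ∈ S)
    (k : ℕ) : l + k * d ∈ S := by
  induction k with
  | zero => simpa using hl
  | succ k ih =>
    have := hS _ ih
    push_cast
    convert this using 1
    ring

theorem add_mul_mem {S : Set ℤ} {d : ℤ} (hS : ∀ l ∈ S, l + d ∈ S) {l k : ℤ} (hl : l ∈ S)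
    (hk : 0 ≤ k) : l + k * d ∈ S := by
  lift k to ℕ using hk
  exact add_natCast_mul_mem hS hl k

/-- A set of integers closed under addition of `d` is generated by its `d`-minimal elements, if
every element can be moved out of it by subtracting multiples of `d`. -/
theorem exists_sub_minimal {S : Set ℤ} {d l : ℤ} (hl : l ∈ S) (h : ∃ k : ℕ, l - k * d ∉ S) :
    ∃ k : ℕ, l - k * d ∈ S ∧ l - k * d - d ∉ S := by
  classical
  have hs := Nat.find_spec h
  have h0 : Nat.find h ≠ 0 := by
    intro h0
    rw [h0] at hs
    simp [hl] at hs
  obtain ⟨k, hk⟩ := Nat.exists_eq_succ_of_ne_zero h0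
  refine ⟨k, ?_, ?_⟩
  · by_contra hc
    have := Nat.find_min' h hc
    omega
  · rw [hk] at hs
    push_cast at hs
    convert hs using 1
    ring_nf

/-! ### Filters, their level sets and their `m`-sets. -/

namespace MNFilter

/-- The set of levels of the points of a filter. -/
def levels (F : MNFilter m n) : Set ℤ := level m n '' F.carrier

theorem level_mem_levels {F : MNFilter m n} {a : ℤ × ℤ} :
    level m n a ∈ F.levels ↔ a ∈ F.carrier := by
  constructor
  · rintro ⟨b, hb, h⟩
    exact F.level_closed b hb a h.symm
  · exact fun h => ⟨a, h, rfl⟩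

theorem levels_injective : Function.Injective (levels : MNFilter m n → Set ℤ) := by
  intro F G h
  ext a
  rw [← level_mem_levels, ← level_mem_levels, h]

theorem add_left_mem_levels (F : MNFilter m n) : ∀ l ∈ F.levels, l + m ∈ F.levels := by
  rintro _ ⟨⟨i, j⟩, h, rfl⟩
  have h' : level m n (i, j) + m = level m n (i + 1, j) := by simp only [level]; ring
  rw [h', level_mem_levels]
  exact F.isUpperSet (Prod.mk_le_mk.2 ⟨by omega, le_rfl⟩) h

theorem add_right_mem_levels (F : MNFilter m n) : ∀ l ∈ F.levels, l + n ∈ F.levels := by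
  rintro _ ⟨⟨i, j⟩, h, rfl⟩
  have h' : level m n (i, j) + n = level m n (i, j + 1) := by simp only [level]; ring
  rw [h', level_mem_levels]
  exact F.isUpperSet (Prod.mk_le_mk.2 ⟨le_rfl, by omega⟩) h

theorem mem_mSet (hm : 0 < m) {F : MNFilter m n} {l : ℤ} : l ∈ F.mSet ↔ l ∈ F.levels ∧ l - m ∉ F.levels := by
  constructor
  · rintro ⟨j, ⟨i, hi, rfl⟩, hmin⟩
    refine ⟨level_mem_levels.2 hi, fun h => ?_⟩
    have h' : level m n (i, j) - m = level m n (i - 1, j) := by simp only [level]; ring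
    rw [h', level_mem_levels] at h
    have h1 := hmin ⟨i - 1, h, rfl⟩
    rw [← h'] at h1
    omega
  · rintro ⟨⟨⟨i, j⟩, hi, rfl⟩, h⟩
    refine ⟨j, ⟨i, hi, rfl⟩, ?_⟩
    rintro _ ⟨i', hi', rfl⟩
    by_contra! hlt
    apply h
    have h' : level m n (i, j) - m = level m n (i - 1, j) := by simp only [level]; ring
    rw [h', level_mem_levels]
    refine F.isUpperSet (Prod.mk_le_mk.2 ⟨?_, le_rfl⟩) hi'
    by_contra! hc
    simp only [level] at hlt
    have : i * (m : ℤ) ≤ i' * m := mul_le_mul_of_nonneg_right (by omega) (by positivity)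
    linarith

/-- If a whole class mod `m` consisted of levels, adding multiples of `n` would reach every class,
and the filter would be everything. -/
theorem exists_sub_notMem_levels (hm : 0 < m) (hmn : Nat.Coprime m n) (F : MNFilter m n) (l : ℤ) :
    ∃ k : ℕ, l - k * m ∉ F.levels := by
  by_contra! hall
  have hall' : ∀ k : ℤ, l + k * m ∈ F.levels := by
    intro k
    rcases le_total 0 k with hk | hk
    · have := hall 0
      simp only [Nat.cast_zero, zero_mul, sub_zero] at this
      exact add_mul_mem F.add_left_mem_levels this hk
    · have := hall (-k).toNat
      rw [Int.toNat_of_nonneg (by omega)] at this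
      convert this using 1
      ring
  refine F.ne_univ (Set.eq_univ_of_forall fun z => ?_)
  rw [← level_mem_levels]
  obtain ⟨⟨x, y⟩, h⟩ := level_surjective hmn (level m n z - l)
  have hy : 0 ≤ y + |y| * m := by
    have h1 := neg_abs_le y
    have h2 : |y| * 1 ≤ |y| * m := mul_le_mul_of_nonneg_left (by omega) (abs_nonneg y)
    linarith
  have := add_mul_mem F.add_right_mem_levels (hall' (x - |y| * n)) hy
  convert this using 1
  simp only [level] at h ⊢
  linear_combination -h

theorem mem_levels_iff (hm : 0 < m) (hmn : Nat.Coprime m n) {F : MNFilter m n} {l : ℤ} :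
    l ∈ F.levels ↔ ∃ k : ℕ, l - k * m ∈ F.mSet := by
  constructor
  · intro hl
    obtain ⟨k, h1, h2⟩ := exists_sub_minimal hl (F.exists_sub_notMem_levels hm hmn l)
    exact ⟨k, (mem_mSet hm).2 ⟨h1, h2⟩⟩
  · rintro ⟨k, hk⟩
    have := add_natCast_mul_mem F.add_left_mem_levels ((mem_mSet hm).1 hk).1 k
    simpa using this

theorem mSet_injective (hm : 0 < m) (hmn : Nat.Coprime m n) :
    Function.Injective (mSet : MNFilter m n → Set ℤ) := by
  intro F G h
  apply levels_injective
  ext l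
  rw [mem_levels_iff hm hmn, mem_levels_iff hm hmn, h]

/-- Replacing `p` by `p + m` in the `m`-set removes the level `p` from the filter. -/
theorem levels_eq_diff (hm : 0 < m) (hmn : Nat.Coprime m n) {F G : MNFilter m n} {p : ℤ}
    (hp : p ∈ F.mSet) (h : G.mSet = (F.mSet \ {p}) ∪ {p + (m : ℤ)}) :
    G.levels = F.levels \ {p} := by
  obtain ⟨hp1, hp2⟩ := (mem_mSet hm).1 hp
  ext l
  rw [mem_levels_iff hm hmn, h]
  constructor
  · rintro ⟨k, ⟨hk, hkp⟩ | hk⟩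
    · refine ⟨(mem_levels_iff hm hmn).2 ⟨k, hk⟩, ?_⟩
      rintro rfl
      rcases k with _ | k
      · simp at hkp
      · apply hp2
        have := add_natCast_mul_mem F.add_left_mem_levels ((mem_mSet hm).1 hk).1 k
        convert this using 1
        push_cast
        ring
    · have hk' : l = p + (k + 1 : ℕ) * m := by
        rw [Set.mem_singleton_iff] at hk
        push_cast
        linarith
      rw [hk']
      refine ⟨add_natCast_mul_mem F.add_left_mem_levels hp1 _, ?_⟩
      have : (0 : ℤ) < (k + 1 : ℕ) * m := by positivity
      simp only [Set.mem_singleton_iff]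
      omega
  · rintro ⟨hl, hlp⟩
    obtain ⟨k, hk⟩ := (mem_levels_iff hm hmn).1 hl
    by_cases hkp : l - k * m = p
    · rcases k with _ | k
      · exact absurd (by simpa using hkp) hlp
      · refine ⟨k, Or.inr ?_⟩
        push_cast at hkp
        rw [Set.mem_singleton_iff]
        linarith
    · exact ⟨k, Or.inl ⟨hk, hkp⟩⟩

theorem mSet_eq_of_levels_eq_diff (hm : 0 < m) {F G : MNFilter m n} {p : ℤ}
    (hp : p ∈ F.mSet) (h : G.levels = F.levels \ {p}) :
    G.mSet = (F.mSet \ {p}) ∪ {p + (m : ℤ)} := by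
  obtain ⟨hp1, hp2⟩ := (mem_mSet hm).1 hp
  have hpm := F.add_left_mem_levels p hp1
  ext l
  simp only [mem_mSet hm, h, Set.mem_union, Set.mem_sdiff, Set.mem_singleton_iff]
  by_cases hlp : l = p + m
  · subst hlp
    have : p + (m : ℤ) ≠ p := by omega
    simp [hpm, this]
  · have : l - m ≠ p := fun hc => hlp (by linarith)
    tauto

/-- The filter with a prescribed set of levels. -/
def ofLevels (hmn : Nat.Coprime m n) (S : Set ℤ) (hm : ∀ l ∈ S, l + m ∈ S)
    (hn : ∀ l ∈ S, l + n ∈ S) (hne : S.Nonempty) (hu : S ≠ Set.univ) : MNFilter m n where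
  carrier := level m n ⁻¹' S
  isUpperSet := by
    rintro ⟨a, b⟩ ⟨c, d⟩ h hab
    obtain ⟨h1, h2⟩ := Prod.mk_le_mk.1 h
    have := add_mul_mem hn (add_mul_mem hm hab (sub_nonneg.2 h1)) (sub_nonneg.2 h2)
    rw [Set.mem_preimage]
    convert this using 1
    simp only [level]
    ring
  level_closed := by
    intro a ha b hb
    rwa [Set.mem_preimage, hb]
  nonempty := by
    obtain ⟨l, hl⟩ := hne
    obtain ⟨a, rfl⟩ := level_surjective hmn l
    exact ⟨a, hl⟩
  ne_univ := by
    intro h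
    refine hu (Set.eq_univ_of_forall fun l => ?_)
    obtain ⟨a, rfl⟩ := level_surjective hmn l
    have : a ∈ level m n ⁻¹' S := h ▸ Set.mem_univ a
    exact this

theorem levels_ofLevels (hmn : Nat.Coprime m n) (S : Set ℤ) (hm : ∀ l ∈ S, l + m ∈ S)
    (hn : ∀ l ∈ S, l + n ∈ S) (hne : S.Nonempty) (hu : S ≠ Set.univ) :
    (ofLevels hmn S hm hn hne hu).levels = S :=
  Set.image_preimage_eq S (level_surjective hmn)

end MNFilter

/-! ### The levels removed by a filter tuple. -/

namespace FilterTuple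

open MNFilter

theorem removed_mem_mSet (P : FilterTuple m n) (i : Fin n) :
    P.removed i ∈ (P.filt i.castSucc).mSet :=
  (P.step i).choose_spec.1

theorem mSet_succ (P : FilterTuple m n) (i : Fin n) : (P.filt i.succ).mSet =
    ((P.filt i.castSucc).mSet \ {P.removed i}) ∪ {P.removed i + (m : ℤ)} :=
  (P.step i).choose_spec.2

theorem mem_levels_iff (hm : 0 < m) (hmn : Nat.Coprime m n) (P : FilterTuple m n)
    (i : Fin (n + 1)) (l : ℤ) : l ∈ (P.filt i).levels ↔
      l ∈ (P.filt 0).levels ∧ ∀ j : Fin n, j.castSucc < i → l ≠ P.removed j := by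
  induction i using Fin.induction with
  | zero => simp
  | succ i ih =>
    rw [levels_eq_diff hm hmn (P.removed_mem_mSet i) (P.mSet_succ i), Set.mem_sdiff, ih, and_assoc,
      Set.mem_singleton_iff]
    refine and_congr_right fun _ => ⟨fun h j hj => ?_, fun h => ⟨fun j hj => h j ?_, h i ?_⟩⟩
    · rcases (Fin.le_castSucc_iff.2 hj).lt_or_eq with hlt | heq
      · exact h.1 j hlt
      · rw [Fin.castSucc_injective n heq]
        exact h.2
    · exact hj.trans (Fin.castSucc_lt_succ)
    · exact Fin.castSucc_lt_succ

theorem mem_levels_last (hm : 0 < m) (hmn : Nat.Coprime m n) (P : FilterTuple m n) (l : ℤ) :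
    l ∈ (P.filt (Fin.last n)).levels ↔ l - n ∈ (P.filt 0).levels := by
  rw [MNFilter.mem_levels_iff hm hmn, MNFilter.mem_levels_iff hm hmn, ← P.cyclic]
  refine exists_congr fun k => ⟨?_, fun h => ⟨_, h, by ring⟩⟩
  rintro ⟨l', hl', h⟩
  simp only at h
  convert hl' using 1
  linarith

theorem removed_mem_levels (hm : 0 < m) (P : FilterTuple m n) (i : Fin n) :
    P.removed i ∈ (P.filt i.castSucc).levels :=
  ((mem_mSet hm).1 (P.removed_mem_mSet i)).1

theorem removed_mem_levels_zero (hm : 0 < m) (hmn : Nat.Coprime m n) (P : FilterTuple m n)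
    (i : Fin n) : P.removed i ∈ (P.filt 0).levels :=
  ((P.mem_levels_iff hm hmn _ _).1 (P.removed_mem_levels hm i)).1

/-- A removed level is missing from the last filter, which is the first one shifted by `n`. Together
with `exists_removed_eq` this identifies the removed levels with the generators of the first level
set under adding `n`. -/
theorem removed_sub_notMem (hm : 0 < m) (hmn : Nat.Coprime m n) (P : FilterTuple m n)
    (i : Fin n) : P.removed i - n ∉ (P.filt 0).levels := by
  rw [← P.mem_levels_last hm hmn, P.mem_levels_iff hm hmn]
  exact fun h => h.2 i (Fin.castSucc_lt_last i) rfl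

theorem removed_injective (hm : 0 < m) (hmn : Nat.Coprime m n) (P : FilterTuple m n) :
    Function.Injective P.removed := by
  have key : ∀ i j : Fin n, i < j → P.removed i ≠ P.removed j := fun i j hij h =>
    ((P.mem_levels_iff hm hmn _ _).1 (P.removed_mem_levels hm j)).2 i
      (Fin.castSucc_lt_castSucc_iff.2 hij) h.symm
  intro i j h
  rcases lt_trichotomy i j with hij | hij | hij
  · exact absurd h (key i j hij)
  · exact hij
  · exact absurd h.symm (key j i hij)

theorem exists_removed_eq (hm : 0 < m) (hmn : Nat.Coprime m n) (P : FilterTuple m n) {l : ℤ}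
    (h : l ∈ (P.filt 0).levels) (h' : l - n ∉ (P.filt 0).levels) : ∃ i, l = P.removed i := by
  rw [← P.mem_levels_last hm hmn, P.mem_levels_iff hm hmn] at h'
  push Not at h'
  obtain ⟨i, -, hi⟩ := h' h
  exact ⟨i, hi⟩

theorem ext_levels (hm : 0 < m) (hmn : Nat.Coprime m n) {P Q : FilterTuple m n}
    (h0 : (P.filt 0).levels = (Q.filt 0).levels) (h : P.removed = Q.removed) : P = Q := by
  apply FilterTuple.ext
  funext i
  apply levels_injective
  ext l
  rw [P.mem_levels_iff hm hmn, Q.mem_levels_iff hm hmn, h0, h]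

end FilterTuple

open MNFilter FilterTuple

/-! ### The map `A`: its values and its injectivity. -/

theorem mem_parkingWords_iff (hm : 0 < m) {w : Fin n → ℕ} : w ∈ parkingWords m n ↔
    (∀ j, w j < m) ∧ ∀ i : ℕ, 1 ≤ i → i ≤ m →
      i * n ≤ (Finset.univ.filter fun j => w j < i).card * m := by
  have hm' : (0 : ℚ) < m := by exact_mod_cast hm
  simp only [parkingWords, Set.mem_ofPred_eq, div_le_iff₀ hm']
  norm_cast

theorem finite_parkingWords (m n : ℕ) : (parkingWords m n).Finite :=
  (Set.Finite.pi fun _ : Fin n => Set.finite_Iio m).subset fun _ hw j _ => hw.1 j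

/-- The point `(t - n, m - a)` is the only one of this level in the strip, and `hsub` makes it the
lowest filter point of its column. -/
theorem mapA_eq_of_removed_eq (hn : 0 < n) (hmn : Nat.Coprime m n) {P : FilterTuple m n}
    {i t : Fin n} {a : ℕ} (h : P.removed i = (t : ℕ) * m - (a : ℤ) * n)
    (hmem : P.removed i ∈ (P.filt 0).levels) (hsub : P.removed i - n ∉ (P.filt 0).levels) :
    mapA P i = a := by
  have ht := t.2
  have hlev : level m n (((t : ℕ) : ℤ) - n, (m : ℤ) - a) = P.removed i := by
    rw [h]
    simp only [level]
    ring
  have hset : {j : ℤ | ∃ x y : ℤ, (P.filt 0).IsStepEndpoint x y ∧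
      level m n (x, y) = P.removed i ∧ y ≤ j ∧ j < m} = Set.Ico ((m : ℤ) - a) m := by
    ext j
    constructor
    · rintro ⟨x, y, ⟨hx1, hx2, -⟩, hl, hj⟩
      rw [← hlev] at hl
      obtain ⟨-, rfl⟩ := level_coords_unique hn hmn hl (by omega) (by omega)
      exact hj
    · rintro hj
      refine ⟨_, _, ⟨by omega, by omega, ?_, ?_⟩, hlev, hj⟩
      · rwa [← hlev, level_mem_levels] at hmem
      · intro b hb
        by_contra! hlt
        apply hsub
        have hb' := add_mul_mem (P.filt 0).add_right_mem_levels (level_mem_levels.2 hb)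
          (show 0 ≤ (m : ℤ) - a - 1 - b by omega)
        convert hb' using 1
        rw [← hlev]
        simp only [level]
        ring
  rw [mapA, hset, ← Finset.coe_Ico, Set.ncard_coe_finset, Int.card_Ico]
  omega

theorem zero_le_of_mem_levels {F : MNFilter m n} (hF : F.IsDyck) {l : ℤ} (h : l ∈ F.levels) :
    0 ≤ l := hF.2 h

theorem exists_removed_coords (hm : 0 < m) (hn : 0 < n) (hmn : Nat.Coprime m n)
    {P : FilterTuple m n} (hP : P ∈ parkingTuples m n) (i : Fin n) :
    mapA P i < m ∧ ∃ t : Fin n, P.removed i = (t : ℕ) * m - (mapA P i : ℤ) * n := by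
  have hmem := P.removed_mem_levels_zero hm hmn i
  have hsub := P.removed_sub_notMem hm hmn i
  have hnn := zero_le_of_mem_levels hP hmem
  obtain ⟨t, a, h⟩ := exists_coords (m := m) hn hmn (P.removed i)
  -- For `a < 0`, the level minus `n` would be `0` plus nonnegative multiples of `m` and `n`, hence
  -- still in the filter.
  have ha : 0 ≤ a := by
    by_contra! hneg
    apply hsub
    have h1 := add_mul_mem (P.filt 0).add_right_mem_levels
      (add_natCast_mul_mem (P.filt 0).add_left_mem_levels hP.1 t) (show 0 ≤ -a - 1 by omega)
    convert h1 using 1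
    rw [h]
    ring
  lift a to ℕ using ha
  rw [mapA_eq_of_removed_eq hn hmn h hmem hsub]
  refine ⟨?_, t, h⟩
  by_contra! hle
  have h1 : (t : ℕ) * m < n * m := Nat.mul_lt_mul_of_pos_right t.2 hm
  have h2 : m * n ≤ a * n := Nat.mul_le_mul_right n hle
  zify at h1 h2
  linarith

/-- The removed levels are determined by the word of column lengths. -/
theorem removed_eq (hm : 0 < m) (hn : 0 < n) (hmn : Nat.Coprime m n)
    {P : FilterTuple m n} (hP : P ∈ parkingTuples m n) (i : Fin n) :
    P.removed i = ((Tuple.sort (mapA P)).symm i : ℕ) * m - (mapA P i : ℤ) * n := by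
  choose t ht using fun i => (exists_removed_coords hm hn hmn hP i).2
  have hinj : Function.Injective t := by
    have key : ∀ i j, t i = t j → mapA P i ≤ mapA P j := by
      intro i j hij
      by_contra! hlt
      apply P.removed_sub_notMem hm hmn j
      have h1 := add_mul_mem (P.filt 0).add_right_mem_levels (P.removed_mem_levels_zero hm hmn i)
        (show 0 ≤ (mapA P i : ℤ) - mapA P j - 1 by omega)
      convert h1 using 1
      rw [ht i, ht j, hij]
      ring
    intro i j hij
    apply P.removed_injective hm hmn
    rw [ht i, ht j, hij, le_antisymm (key i j hij) (key j i hij.symm)]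
  let σ : Equiv.Perm (Fin n) := Equiv.ofBijective t (Finite.injective_iff_bijective.1 hinj)
  have hσ : ∀ i, t (σ.symm i) = i := fun i => σ.apply_symm_apply i
  -- `Tuple.sort` is the stable sort: lengths weakly increase with the column, and ties are ordered
  -- by label.
  have hsort : σ.symm = Tuple.sort (mapA P) := by
    rw [Tuple.eq_sort_iff]
    constructor
    · intro i j hij
      simp only [Function.comp_apply]
      by_contra! hlt
      apply P.removed_sub_notMem hm hmn (σ.symm j)
      have h1 := add_mul_mem (P.filt 0).add_right_mem_levels (add_mul_mem
        (P.filt 0).add_left_mem_levels (P.removed_mem_levels_zero hm hmn (σ.symm i))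
        (show 0 ≤ ((j : ℕ) : ℤ) - (i : ℕ) from sub_nonneg.2 (by exact_mod_cast hij)))
        (show 0 ≤ (mapA P (σ.symm i) : ℤ) - mapA P (σ.symm j) - 1 by omega)
      convert h1 using 1
      rw [ht, ht, hσ, hσ]
      ring
    -- With equal lengths the level of column `j` exceeds that of column `i` by `(j - i) * m`, so it
    -- is in the `m`-set only once the latter is gone.
    · intro i j hij h
      by_contra! hle
      apply ((mem_mSet hm).1 (P.removed_mem_mSet (σ.symm j))).2
      have hij' : (i : ℕ) < j := hij
      have h0 := (P.mem_levels_iff hm hmn _ _).1 (P.removed_mem_levels hm (σ.symm i))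
      have h1 : P.removed (σ.symm i) ∈ (P.filt (σ.symm j).castSucc).levels :=
        (P.mem_levels_iff hm hmn _ _).2
          ⟨h0.1, fun k hk => h0.2 k (hk.trans_le (Fin.castSucc_le_castSucc_iff.2 hle))⟩
      have h2 := add_mul_mem (MNFilter.add_left_mem_levels _) h1
        (show 0 ≤ ((j : ℕ) : ℤ) - (i : ℕ) - 1 by omega)
      convert h2 using 1
      rw [ht, ht, hσ, hσ, h]
      ring
  rw [← hsort]
  exact ht i

theorem mapA_injOn (hm : 0 < m) (hn : 0 < n) (hmn : Nat.Coprime m n) :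
    Set.InjOn mapA (parkingTuples m n) := by
  intro P hP Q hQ h
  have hr : P.removed = Q.removed := by
    funext i
    rw [removed_eq hm hn hmn hP, removed_eq hm hn hmn hQ, h]
  -- The first level set is generated by the removed levels under adding `n`.
  have key : ∀ {P Q : FilterTuple m n}, P ∈ parkingTuples m n → P.removed = Q.removed →
      (P.filt 0).levels ⊆ (Q.filt 0).levels := by
    intro P Q hP h l hl
    have hex : ∃ k : ℕ, l - k * n ∉ (P.filt 0).levels := by
      refine ⟨l.toNat + 1, fun hc => ?_⟩
      have h1 := zero_le_of_mem_levels hP hc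
      have h2 := Int.self_le_toNat l
      have h3 : ((l.toNat + 1 : ℕ) : ℤ) * 1 ≤ ((l.toNat + 1 : ℕ) : ℤ) * n :=
        mul_le_mul_of_nonneg_left (by omega) (by positivity)
      push_cast at h1 h3
      linarith
    obtain ⟨k, h1, h2⟩ := exists_sub_minimal hl hex
    obtain ⟨i, hi⟩ := P.exists_removed_eq hm hmn h1 h2
    rw [h] at hi
    have h3 := add_natCast_mul_mem (Q.filt 0).add_right_mem_levels
      (Q.removed_mem_levels_zero hm hmn i) k
    rwa [← hi, sub_add_cancel] at h3
  exact FilterTuple.ext_levels hm hmn ((key hP hr).antisymm (key hQ hr.symm)) hr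

theorem mapA_mapsTo (hm : 0 < m) (hn : 0 < n) (hmn : Nat.Coprime m n) :
    Set.MapsTo mapA (parkingTuples m n) (parkingWords m n) := by
  intro P hP
  rw [mem_parkingWords_iff hm]
  refine ⟨fun j => (exists_removed_coords hm hn hmn hP j).1, fun i _ him => ?_⟩
  by_contra! hlt
  set c := (Finset.univ.filter fun j => mapA P j < i).card with hc
  have hcn : c < n := by
    have h1 : i * n ≤ m * n := Nat.mul_le_mul_right n him
    by_contra! hle
    have h2 : n * m ≤ c * m := Nat.mul_le_mul_right m hle
    linarith
  -- Nonnegativity in sorted position `s ≤ c` bounds the letter times `n` by `c * m < i * n`; so `c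
  -- + 1` letters would be smaller than `i`.
  have hsub : (Finset.Iic (⟨c, hcn⟩ : Fin n)).map (Tuple.sort (mapA P)).toEmbedding ⊆
      Finset.univ.filter fun j => mapA P j < i := by
    intro j hj
    obtain ⟨s, hs, rfl⟩ := Finset.mem_map.1 hj
    rw [Finset.mem_filter]
    refine ⟨Finset.mem_univ _, ?_⟩
    have h1 := removed_eq hm hn hmn hP (Tuple.sort (mapA P) s)
    have h2 := zero_le_of_mem_levels hP
      (P.removed_mem_levels_zero hm hmn (Tuple.sort (mapA P) s))
    rw [Equiv.symm_apply_apply] at h1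
    have hs' : (s : ℕ) ≤ c := Fin.le_def.1 (Finset.mem_Iic.1 hs)
    have h3 : (s : ℕ) * m ≤ c * m := Nat.mul_le_mul_right m hs'
    by_contra! hle
    have h4 : i * n ≤ mapA P (Tuple.sort (mapA P) s) * n := Nat.mul_le_mul_right n hle
    zify at h3 h4 hlt
    linarith
  have := Finset.card_le_card hsub
  rw [Finset.card_map, Fin.card_Iic, ← hc] at this
  simp at this

/-! ### The inverse of `A`: the tuple of a parking word. -/

/-- The level attached to the `j`-th letter of a word by its labelled lattice path. -/
def pathLevel (m : ℕ) (w : Fin n → ℕ) (j : Fin n) : ℤ :=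
  ((Tuple.sort w).symm j : ℕ) * m - (w j : ℤ) * n

/-- The levels that are left in step `i` of the filter tuple with path levels given by `w`. -/
def pathLevels (m : ℕ) (w : Fin n → ℕ) (i : Fin (n + 1)) : Set ℤ :=
  {l | ∃ (j : Fin n) (k : ℕ), l = pathLevel m w j + k * n ∧ (i ≤ j.castSucc ∨ 1 ≤ k)}

theorem pathLevel_add_unique (hmn : Nat.Coprime m n) {w : Fin n → ℕ} {j j' : Fin n}
    {k k' : ℤ} (h : pathLevel m w j + k * n = pathLevel m w j' + k' * n) : j = j' ∧ k = k' := by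
  have hj := ((Tuple.sort w).symm j).2
  have hj' := ((Tuple.sort w).symm j').2
  obtain ⟨h1, h2⟩ := level_coords_unique (x := ((Tuple.sort w).symm j : ℕ))
    (x' := ((Tuple.sort w).symm j' : ℕ)) (y := k - w j) (y' := k' - w j') j.pos hmn
    (by simp only [pathLevel] at h; linear_combination h) (by omega) (by omega)
  have h3 : j = j' := (Tuple.sort w).symm.injective (Fin.ext (by exact_mod_cast h1))
  subst h3
  exact ⟨rfl, by linarith⟩

theorem add_right_mem_pathLevels (w : Fin n → ℕ) (i : Fin (n + 1)) :
    ∀ l ∈ pathLevels m w i, l + n ∈ pathLevels m w i := by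
  rintro _ ⟨j, k, rfl, -⟩
  exact ⟨j, k + 1, by push_cast; ring, Or.inr (by omega)⟩

/-- Adding `m` moves to the next sorted column, whose letter is no smaller; the increase becomes a
multiple of `n`. If it is zero, stability gives the next column a larger label, so it is not yet
removed. The last column wraps to the first, gaining at least one `n` because letters are less than
`m`. -/
theorem add_left_mem_pathLevels {w : Fin n → ℕ} (hw : ∀ j, w j < m) (i : Fin (n + 1)) :
    ∀ l ∈ pathLevels m w i, l + m ∈ pathLevels m w i := by
  rintro _ ⟨j, k, rfl, hk⟩
  obtain ⟨s, rfl⟩ := (Tuple.sort w).surjective j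
  obtain ⟨hmono, htie⟩ := Tuple.eq_sort_iff.1 (rfl : Tuple.sort w = Tuple.sort w)
  by_cases hs : (s : ℕ) + 1 < n
  · have hlt : s < ⟨s + 1, hs⟩ := Fin.lt_def.2 (Nat.lt_succ_self _)
    have h1 := hmono hlt.le
    have h2 := htie _ _ hlt
    set s' : Fin n := ⟨s + 1, hs⟩ with hs'
    simp only [Function.comp_apply] at h1
    refine ⟨Tuple.sort w s', k + (w (Tuple.sort w s') - w (Tuple.sort w s)), ?_, ?_⟩
    · simp only [pathLevel, Equiv.symm_apply_apply]
      push_cast [h1]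
      rw [hs']
      push_cast
      ring
    · rcases hk with hk | hk
      · rcases h1.lt_or_eq with h3 | h3
        · right; omega
        · left
          exact hk.trans (Fin.castSucc_le_castSucc_iff.2 (h2 h3).le)
      · right; omega
  · have hs1 : (s : ℕ) + 1 = n := by omega
    set s' : Fin n := ⟨0, s.pos⟩ with hs'
    have hws := hw (Tuple.sort w s)
    refine ⟨Tuple.sort w s', k + (m - w (Tuple.sort w s)) + w (Tuple.sort w s'), ?_,
      Or.inr (by omega)⟩
    simp only [pathLevel, Equiv.symm_apply_apply]
    have hs2 : (((s : ℕ) : ℤ)) = n - 1 := by omega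
    push_cast [hws.le]
    rw [hs2, hs']
    push_cast
    ring

theorem pathLevel_nonneg (hm : 0 < m) {w : Fin n → ℕ} (hw : w ∈ parkingWords m n) (j : Fin n) :
    0 ≤ pathLevel m w j := by
  obtain ⟨h1, h2⟩ := (mem_parkingWords_iff hm).1 hw
  rcases Nat.eq_zero_or_pos (w j) with h0 | h0
  · simp only [pathLevel, h0, Nat.cast_zero, zero_mul, sub_zero]
    positivity
  · have h3 := h2 (w j) h0 (h1 j).le
    -- Letters smaller than `w j` occupy sorted positions before that of `j`, so the parking
    -- inequality at `w j` bounds the column from below.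
    have hsub : (Finset.univ.filter fun k => w k < w j).map (Tuple.sort w).symm.toEmbedding ⊆
        Finset.Iio ((Tuple.sort w).symm j) := by
      intro s hs
      obtain ⟨k, hk, rfl⟩ := Finset.mem_map.1 hs
      rw [Finset.mem_Iio]
      by_contra! hle
      have := Tuple.monotone_sort w hle
      simp at this hk
      omega
    have h4 := Finset.card_le_card hsub
    rw [Finset.card_map, Fin.card_Iio] at h4
    have h5 := Nat.mul_le_mul_right m h4
    simp only [pathLevel]
    zify at h3 h5
    linarith

/-- The first sorted column has level `-w * n`, where `w` is its letter; being nonnegative, it is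
`0`. -/
theorem zero_mem_pathLevels (hm : 0 < m) (hn : 0 < n) {w : Fin n → ℕ}
    (hw : w ∈ parkingWords m n) : 0 ∈ pathLevels m w 0 := by
  refine ⟨Tuple.sort w ⟨0, hn⟩, 0, ?_, Or.inl (Fin.zero_le _)⟩
  have h := pathLevel_nonneg hm hw (Tuple.sort w ⟨0, hn⟩)
  simp only [pathLevel, Equiv.symm_apply_apply, Nat.cast_zero, zero_mul, zero_sub] at h ⊢
  have : (0 : ℤ) ≤ (w (Tuple.sort w ⟨0, hn⟩) : ℤ) * n := by positivity
  linarith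

theorem nonneg_of_mem_pathLevels (hm : 0 < m) {w : Fin n → ℕ} (hw : w ∈ parkingWords m n)
    {i : Fin (n + 1)} {l : ℤ} (hl : l ∈ pathLevels m w i) : 0 ≤ l := by
  obtain ⟨j, k, rfl, -⟩ := hl
  have := pathLevel_nonneg hm hw j
  positivity

theorem pathLevel_mem (m : ℕ) (w : Fin n → ℕ) (j : Fin n) :
    pathLevel m w j ∈ pathLevels m w j.castSucc := ⟨j, 0, by simp, Or.inl le_rfl⟩

theorem pathLevels_succ (hmn : Nat.Coprime m n) (w : Fin n → ℕ) (i : Fin n) :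
    pathLevels m w i.succ = pathLevels m w i.castSucc \ {pathLevel m w i} := by
  ext l
  rw [Set.mem_sdiff, Set.mem_singleton_iff]
  constructor
  · rintro ⟨j, k, rfl, hk⟩
    refine ⟨⟨j, k, rfl, hk.imp_left Fin.castSucc_lt_succ.le.trans⟩, fun h => ?_⟩
    obtain ⟨rfl, hk0⟩ := pathLevel_add_unique hmn
      (show pathLevel m w j + (k : ℤ) * n = pathLevel m w i + (0 : ℤ) * n by linarith)
    rcases hk with hk | hk
    · exact absurd Fin.castSucc_lt_succ hk.not_gt
    · omega
  · rintro ⟨⟨j, k, rfl, hk⟩, hne⟩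
    refine ⟨j, k, rfl, ?_⟩
    rcases Nat.eq_zero_or_pos k with rfl | hk0
    · left
      have hij : i ≠ j := by
        rintro rfl
        simp at hne
      have hle : i ≤ j := Fin.castSucc_le_castSucc_iff.1 (hk.resolve_right (by omega))
      exact Fin.succ_le_castSucc_iff.2 (hle.lt_of_ne hij)
    · exact Or.inr hk0

theorem mem_pathLevels_last (w : Fin n → ℕ) (l : ℤ) :
    l ∈ pathLevels m w (Fin.last n) ↔ l - n ∈ pathLevels m w 0 := by
  constructor
  · rintro ⟨j, k, rfl, hk⟩
    have hk' : 1 ≤ k := hk.resolve_left (Fin.castSucc_lt_last j).not_ge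
    obtain ⟨k, rfl⟩ := Nat.exists_eq_add_of_le' hk'
    exact ⟨j, k, by push_cast; ring, Or.inl (Fin.zero_le _)⟩
  · rintro ⟨j, k, h, -⟩
    exact ⟨j, k + 1, by push_cast; linarith, Or.inr (by omega)⟩

/-- The filter with levels `pathLevels m w i`. -/
def pathFilter (hm : 0 < m) (hn : 0 < n) (hmn : Nat.Coprime m n) {w : Fin n → ℕ}
    (hw : w ∈ parkingWords m n) (i : Fin (n + 1)) : MNFilter m n :=
  ofLevels hmn (pathLevels m w i) (add_left_mem_pathLevels hw.1 i) (add_right_mem_pathLevels w i)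
    ⟨_, ⟨0, hn⟩, 1, rfl, Or.inr le_rfl⟩
    (fun h => absurd (nonneg_of_mem_pathLevels hm hw (h ▸ Set.mem_univ (-1 : ℤ))) (by norm_num))

theorem levels_pathFilter (hm : 0 < m) (hn : 0 < n) (hmn : Nat.Coprime m n) {w : Fin n → ℕ}
    (hw : w ∈ parkingWords m n) (i : Fin (n + 1)) :
    (pathFilter hm hn hmn hw i).levels = pathLevels m w i :=
  levels_ofLevels _ _ _ _ _ _

/-- If the level minus `m` were present, it would survive the removal, and closure under `m` would
bring the removed level back. -/
theorem pathLevel_mem_mSet (hm : 0 < m) (hn : 0 < n) (hmn : Nat.Coprime m n) {w : Fin n → ℕ}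
    (hw : w ∈ parkingWords m n) (i : Fin n) :
    pathLevel m w i ∈ (pathFilter hm hn hmn hw i.castSucc).mSet := by
  rw [mem_mSet hm, levels_pathFilter]
  refine ⟨pathLevel_mem m w i, fun h => ?_⟩
  have h1 : pathLevel m w i - m ∈ pathLevels m w i.succ := by
    rw [pathLevels_succ hmn]
    refine ⟨h, ?_⟩
    rw [Set.mem_singleton_iff]
    omega
  have h2 := add_left_mem_pathLevels hw.1 _ _ h1
  rw [sub_add_cancel, pathLevels_succ hmn] at h2
  exact h2.2 rfl

/-- The filter tuple whose labelled lattice path has the parking word `w` as its word of column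
lengths. -/
def pathTuple (hm : 0 < m) (hn : 0 < n) (hmn : Nat.Coprime m n) {w : Fin n → ℕ}
    (hw : w ∈ parkingWords m n) : FilterTuple m n where
  filt := pathFilter hm hn hmn hw
  step i := ⟨pathLevel m w i, pathLevel_mem_mSet hm hn hmn hw i,
    mSet_eq_of_levels_eq_diff hm (pathLevel_mem_mSet hm hn hmn hw i)
      (by rw [levels_pathFilter, levels_pathFilter, pathLevels_succ hmn])⟩
  cyclic := by
    ext l
    rw [mem_mSet hm, levels_pathFilter, mem_pathLevels_last, mem_pathLevels_last]
    constructor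
    · rintro ⟨l, hl, rfl⟩
      rw [mem_mSet hm, levels_pathFilter] at hl
      convert hl using 3 <;> ring
    · intro hl
      refine ⟨l - n, ?_, by ring⟩
      rw [mem_mSet hm, levels_pathFilter]
      convert hl using 3
      ring

theorem removed_pathTuple (hm : 0 < m) (hn : 0 < n) (hmn : Nat.Coprime m n) {w : Fin n → ℕ}
    (hw : w ∈ parkingWords m n) (i : Fin n) :
    (pathTuple hm hn hmn hw).removed i = pathLevel m w i :=
  (removed_unique hm _ i _ (pathLevel_mem_mSet hm hn hmn hw i)
    (mSet_eq_of_levels_eq_diff hm (pathLevel_mem_mSet hm hn hmn hw i)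
      (by
        change (pathFilter hm hn hmn hw i.succ).levels =
          (pathFilter hm hn hmn hw i.castSucc).levels \ _
        rw [levels_pathFilter, levels_pathFilter, pathLevels_succ hmn]))).symm

theorem pathTuple_mem (hm : 0 < m) (hn : 0 < n) (hmn : Nat.Coprime m n) {w : Fin n → ℕ}
    (hw : w ∈ parkingWords m n) : pathTuple hm hn hmn hw ∈ parkingTuples m n := by
  change IsLeast (pathFilter hm hn hmn hw 0).levels 0
  rw [levels_pathFilter]
  exact ⟨zero_mem_pathLevels hm hn hw, fun l hl => nonneg_of_mem_pathLevels hm hw hl⟩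

theorem mapA_pathTuple (hm : 0 < m) (hn : 0 < n) (hmn : Nat.Coprime m n) {w : Fin n → ℕ}
    (hw : w ∈ parkingWords m n) : mapA (pathTuple hm hn hmn hw) = w := by
  funext i
  exact mapA_eq_of_removed_eq hn hmn (removed_pathTuple hm hn hmn hw i)
    (removed_mem_levels_zero hm hmn _ i) (removed_sub_notMem hm hmn _ i)

theorem mapA_bijOn (hm : 0 < m) (hn : 0 < n) (hmn : Nat.Coprime m n) :
    Set.BijOn mapA (parkingTuples m n) (parkingWords m n) :=
  ⟨mapA_mapsTo hm hn hmn, mapA_injOn hm hn hmn, fun _ hw =>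
    ⟨pathTuple hm hn hmn hw, pathTuple_mem hm hn hmn hw, mapA_pathTuple hm hn hmn hw⟩⟩

/-! ### The map `B`: `m`-sets as sorted vectors. -/

theorem exists_perm_comp_eq {α β : Type*} {f g : α → β} (hf : Function.Injective f)
    (hg : Function.Injective g) (h : Set.range f = Set.range g) :
    ∃ σ : Equiv.Perm α, f = g ∘ σ := by
  refine ⟨(Equiv.ofInjective f hf).trans
    ((Equiv.setCongr h).trans (Equiv.ofInjective g hg).symm), ?_⟩
  funext a
  simp [Equiv.apply_ofInjective_symm]

namespace MNFilter

/-- Minimality under subtracting `m` leaves at most one element per class; adding multiples of `n`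
to any level reaches every class. -/
theorem mSet_bijective (hm : 0 < m) (hmn : Nat.Coprime m n) (F : MNFilter m n) :
    Function.Bijective fun l : F.mSet => ((l : ℤ) : ZMod m) := by
  constructor
  · have key : ∀ l ∈ F.mSet, ∀ l' ∈ F.mSet, (l : ZMod m) = (l' : ZMod m) → l ≤ l' := by
      intro l hl l' hl' h
      by_contra! hlt
      obtain ⟨k, hk⟩ := (ZMod.intCast_eq_intCast_iff_dvd_sub _ _ _).1 h.symm
      have hm' : (0 : ℤ) < m := by exact_mod_cast hm
      have hk0 : 0 < k := by
        by_contra! hk0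
        have := mul_nonpos_of_nonneg_of_nonpos hm'.le hk0
        omega
      apply ((mem_mSet hm).1 hl).2
      have := add_mul_mem F.add_left_mem_levels ((mem_mSet hm).1 hl').1
        (show 0 ≤ k - 1 by omega)
      convert this using 1
      linear_combination hk
    rintro ⟨l, hl⟩ ⟨l', hl'⟩ h
    exact Subtype.ext (le_antisymm (key l hl l' hl' h) (key l' hl' l hl h.symm))
  · intro r
    have : NeZero m := ⟨hm.ne'⟩
    obtain ⟨l, hl⟩ : F.levels.Nonempty := F.nonempty.image _
    have h1 := add_natCast_mul_mem F.add_right_mem_levels hl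
      ((r - (l : ZMod m)) * (n : ZMod m)⁻¹).val
    obtain ⟨k, hk⟩ := (F.mem_levels_iff hm hmn).1 h1
    refine ⟨⟨_, hk⟩, ?_⟩
    have hinv := ZMod.coe_mul_inv_eq_one n hmn.symm
    push_cast
    rw [ZMod.natCast_zmod_val, ZMod.natCast_self]
    linear_combination (r - (l : ZMod m)) * hinv

theorem exists_strictMono_range_eq (hm : 0 < m) (hmn : Nat.Coprime m n) (F : MNFilter m n) :
    ∃ x : Fin m → ℤ, StrictMono x ∧ Set.range x = F.mSet := by
  have : NeZero m := ⟨hm.ne'⟩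
  have e := Equiv.ofBijective _ (F.mSet_bijective hm hmn)
  have : Finite F.mSet := Finite.of_equiv _ e.symm
  have hfin : F.mSet.Finite := Set.toFinite _
  have hcard : hfin.toFinset.card = m := by
    rw [← Set.ncard_eq_toFinset_card _ hfin, ← Nat.card_coe_set_eq, Nat.card_congr e,
      Nat.card_zmod]
  refine ⟨hfin.toFinset.orderEmbOfFin hcard, OrderEmbedding.strictMono _, ?_⟩
  rw [Finset.range_orderEmbOfFin, Set.Finite.coe_toFinset]

theorem intCast_injective_of_range_eq (hm : 0 < m) (hmn : Nat.Coprime m n) {F : MNFilter m n}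
    {x : Fin m → ℤ} (hx : StrictMono x) (hr : Set.range x = F.mSet) :
    Function.Injective fun k => (x k : ZMod m) := by
  intro k k' h
  have hmem : ∀ k, x k ∈ F.mSet := fun k => hr ▸ Set.mem_range_self k
  have := (F.mSet_bijective hm hmn).1 (a₁ := ⟨x k, hmem k⟩) (a₂ := ⟨x k', hmem k'⟩) h
  exact hx.injective (congrArg Subtype.val this)

end MNFilter

/-- A sequence of strictly increasing vectors, each of which arises from the previous one by adding
`m` to the entry in position `c i` and sorting; the last one is the first one shifted by `n`. -/
structure IsSortedOrbit (m n : ℕ) (c : Fin n → Fin m) (X : Fin (n + 1) → Fin m → ℤ) : Prop where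
  strictMono : ∀ i, StrictMono (X i)
  step : ∀ i : Fin n, ∃ σ : Equiv.Perm (Fin m),
    X i.succ = (X i.castSucc + Pi.single (c i) (m : ℤ)) ∘ σ
  last : ∀ k, X (Fin.last n) k = X 0 k + n

/-- The sorted `m`-sets of a filter tuple. -/
theorem FilterTuple.exists_isSortedOrbit (hm : 0 < m) (hmn : Nat.Coprime m n)
    (P : FilterTuple m n) : ∃ (c : Fin n → Fin m) (X : Fin (n + 1) → Fin m → ℤ),
      (∀ i, Set.range (X i) = (P.filt i).mSet) ∧ (∀ i, mapB P i = c i) ∧ IsSortedOrbit m n c X := by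
  choose X hX hr using fun i => (P.filt i).exists_strictMono_range_eq hm hmn
  have hc : ∀ i : Fin n, ∃ k, X i.castSucc k = P.removed i := fun i => by
    have := P.removed_mem_mSet i
    rwa [← hr] at this
  choose c hc using hc
  refine ⟨c, X, hr, fun i => ?_, hX, fun i => ?_, fun k => ?_⟩
  · have : {l : ℤ | l ∈ (P.filt i.castSucc).mSet ∧ l < P.removed i} =
        X i.castSucc '' (Finset.Iio (c i) : Finset (Fin m)) := by
      ext l
      rw [← hr, ← hc]
      constructor
      · rintro ⟨⟨k, rfl⟩, hk⟩
        exact ⟨k, by simpa using (hX _).lt_iff_lt.1 hk, rfl⟩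
      · rintro ⟨k, hk, rfl⟩
        exact ⟨⟨k, rfl⟩, hX _ (by simpa using hk)⟩
    rw [mapB, this, Set.ncard_image_of_injective _ (hX _).injective, Set.ncard_coe_finset,
      Fin.card_Iio]
  · have hpm : P.removed i + m ∉ (P.filt i.castSucc).mSet := fun h => by
      have := ((mem_mSet hm).1 h).2
      rw [add_sub_cancel_right] at this
      exact this (P.removed_mem_levels hm i)
    have heq : X i.castSucc + Pi.single (c i) (m : ℤ) =
        Function.update (X i.castSucc) (c i) (P.removed i + m) := by
      funext k
      rcases eq_or_ne k (c i) with rfl | hk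
      · simp [hc]
      · simp [hk]
    have hne : ∀ k, X i.castSucc k ≠ P.removed i + m := fun k h =>
      hpm (h ▸ hr i.castSucc ▸ Set.mem_range_self k)
    rw [heq]
    refine exists_perm_comp_eq (hX _).injective ?_ ?_
    · intro k k' h
      rcases eq_or_ne k (c i) with rfl | hk <;> rcases eq_or_ne k' (c i) with rfl | hk'
      · rfl
      · simp [hk'] at h
        exact absurd h.symm (hne _)
      · simp [hk] at h
        exact absurd h (hne _)
      · simp [hk, hk'] at h
        exact (hX _).injective h
    · rw [hr, P.mSet_succ, ← hr]
      ext l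
      constructor
      · rintro (⟨⟨k, rfl⟩, hk⟩ | hl)
        · refine ⟨k, ?_⟩
          have : k ≠ c i := by
            rintro rfl
            exact hk (hc i)
          simp [this]
        · refine ⟨c i, ?_⟩
          rw [Set.mem_singleton_iff.1 hl]
          simp
      · rintro ⟨k, rfl⟩
        rcases eq_or_ne k (c i) with rfl | hk
        · right
          simp
        · left
          refine ⟨⟨k, by simp [hk]⟩, ?_⟩
          simp only [ne_eq, hk, not_false_eq_true, Function.update_of_ne, Set.mem_singleton_iff]
          rw [← hc]
          exact fun h => hk ((hX _).injective h)
  · have hs : StrictMono fun k => X 0 k + (n : ℤ) := (hX 0).add_const _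
    have : Set.range (X (Fin.last n)) = Set.range fun k => X 0 k + (n : ℤ) := by
      rw [hr, ← P.cyclic, ← hr, ← Set.range_comp]
      rfl
    exact congrFun (((hX _).range_inj hs).1 this) k

/-! ### Sorted orbits: parking inequality and rigidity. -/

namespace IsSortedOrbit

variable {c : Fin n → Fin m} {X Y : Fin (n + 1) → Fin m → ℤ}

/-- Adding `m` and sorting increases the sum of the `i` smallest entries by at most `m`, and leaves
it unchanged if `m` is added to another entry. -/
theorem sum_ite_succ_le (hX : IsSortedOrbit m n c X) (i : ℕ) (j : Fin n) :
    ∑ k : Fin m, X j.succ k * (if (k : ℕ) < i then 1 else 0) ≤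
      ∑ k : Fin m, X j.castSucc k * (if (k : ℕ) < i then 1 else 0) +
        if (c j : ℕ) < i then (m : ℤ) else 0 := by
  obtain ⟨σ, hσ⟩ := hX.step j
  -- Pairing with the indicator of the first `i` positions is smallest in increasing order, by the
  -- rearrangement inequality.
  have hanti : Antivary (X j.succ) fun k : Fin m => if (k : ℕ) < i then (1 : ℤ) else 0 := by
    refine ((hX.strictMono _).monotone).antivary fun a b hab => ?_
    have : (a : ℕ) ≤ b := hab
    split_ifs <;> omega
  have h1 := hanti.sum_mul_le_sum_mul_comp_perm (σ := σ)
  refine h1.trans (le_of_eq ?_)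
  rw [hσ]
  simp only [Function.comp_apply]
  refine (Equiv.sum_comp σ fun k => (X j.castSucc + Pi.single (c j) (m : ℤ) : Fin m → ℤ) k *
    (if (k : ℕ) < i then 1 else 0)).trans ?_
  simp only [Pi.add_apply, add_mul, Finset.sum_add_distrib]
  congr 1
  rw [Finset.sum_eq_single (c j)]
  · simp
  · intro k _ hk
    simp [hk]
  · simp

/-- Telescope the sum of the `i` smallest entries: it grows by `i * n` in total, and by at most `m`
in each step with `c j < i`, not at all in the others. -/
theorem mul_le_card_mul (hX : IsSortedOrbit m n c X) {i : ℕ} (hi : i ≤ m) :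
    i * n ≤ (Finset.univ.filter fun j => (c j : ℕ) < i).card * m := by
  set s : Fin (n + 1) → ℤ := fun j => ∑ k : Fin m, X j k * (if (k : ℕ) < i then 1 else 0) with hs
  have h1 : ∑ j : Fin n, (s j.succ - s j.castSucc) ≤
      ∑ j : Fin n, if (c j : ℕ) < i then (m : ℤ) else 0 :=
    Finset.sum_le_sum fun j _ => by
      have := hX.sum_ite_succ_le i j
      simp only [hs]
      linarith
  have h2 : ∑ j : Fin n, (s j.succ - s j.castSucc) = s (Fin.last n) - s 0 := by
    rw [Finset.sum_sub_distrib]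
    have ha := Fin.sum_univ_succ s
    have hb := Fin.sum_univ_castSucc s
    linarith
  have h3 : s (Fin.last n) - s 0 = i * n := by
    simp only [hs, hX.last, add_mul, Finset.sum_add_distrib, add_sub_cancel_left]
    rw [← Finset.mul_sum, Fin.sum_univ_eq_sum_range (fun k => if k < i then (1 : ℤ) else 0),
      ← Finset.sum_filter]
    have : (Finset.range m).filter (· < i) = Finset.range i := by
      ext k
      simp only [Finset.mem_filter, Finset.mem_range]
      omega
    rw [this]
    simp [mul_comm]
  rw [h2, h3, ← Finset.sum_filter, Finset.sum_const, nsmul_eq_mul] at h1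
  exact_mod_cast h1

/-- For strictly increasing rearrangements, sorting decreases the Euclidean distance, strictly
unless both vectors are sorted by the same permutation. -/
theorem sum_sq_sub_comp_perm {u v : Fin m → ℤ} {σ τ : Equiv.Perm (Fin m)}
    (hu : StrictMono (u ∘ σ)) (hv : StrictMono (v ∘ τ)) :
    ∑ k, (u (σ k) - v (τ k)) ^ 2 ≤ ∑ k, (u k - v k) ^ 2 ∧
      (∑ k, (u (σ k) - v (τ k)) ^ 2 = ∑ k, (u k - v k) ^ 2 → σ = τ) := by
  have expand : ∀ f g : Fin m → ℤ, ∑ k, (f k - g k) ^ 2 =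
      ∑ k, f k ^ 2 + ∑ k, g k ^ 2 - 2 * ∑ k, f k * g k := by
    intro f g
    rw [Finset.mul_sum, ← Finset.sum_add_distrib, ← Finset.sum_sub_distrib]
    exact Finset.sum_congr rfl fun k _ => by ring
  have hmono : Monovary (u ∘ σ) (v ∘ τ) := hu.monotone.monovary hv.monotone
  have h1 := hmono.sum_mul_comp_perm_le_sum_mul (σ := σ.trans τ.symm)
  have h2 := hmono.sum_mul_comp_perm_eq_sum_mul_iff (σ := σ.trans τ.symm)
  simp only [Function.comp_apply, Equiv.trans_apply, Equiv.apply_symm_apply] at h1 h2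
  rw [Equiv.sum_comp σ fun k => u k * v k] at h1 h2
  rw [expand u v, expand (fun k => u (σ k)) (fun k => v (τ k)),
    Equiv.sum_comp σ fun k => u k ^ 2, Equiv.sum_comp τ fun k => v k ^ 2]
  refine ⟨by linarith, fun h => ?_⟩
  have hvary := h2.1 (by linarith)
  -- Equality in the rearrangement inequality makes `τ⁻¹ ∘ σ` increasing, and the only increasing
  -- permutation of `Fin m` is the identity.
  have hρ : StrictMono (σ.trans τ.symm) := by
    intro a b hab
    by_contra! hle
    have hlt : (σ.trans τ.symm) b < (σ.trans τ.symm) a :=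
      hle.lt_of_ne fun h => hab.ne ((σ.trans τ.symm).injective h.symm)
    exact (hvary (i := b) (j := a) (hv hlt)).not_gt (hu hab)
  have hid : ⇑(σ.trans τ.symm) = id :=
    (hρ.range_inj strictMono_id).1 (by rw [(Equiv.surjective _).range_eq, Set.range_id])
  ext k
  have := congrFun hid k
  simp only [Equiv.trans_apply, id_eq] at this
  rw [← this, Equiv.apply_symm_apply, this]

/-- Two orbits with the same word are sorted by the same permutations. -/
theorem exists_common_perm (hX : IsSortedOrbit m n c X) (hY : IsSortedOrbit m n c Y) (i : Fin n) :
    ∃ σ : Equiv.Perm (Fin m), X i.succ = (X i.castSucc + Pi.single (c i) (m : ℤ)) ∘ σ ∧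
      Y i.succ = (Y i.castSucc + Pi.single (c i) (m : ℤ)) ∘ σ := by
  choose σ hσ using hX.step
  choose τ hτ using hY.step
  -- The increments at `c i` cancel in the difference, so only sorting changes `D`; as both orbits
  -- end shifted by `n`, `D` is constant.
  set D : Fin (n + 1) → ℤ := fun i => ∑ k, (X i k - Y i k) ^ 2 with hD
  have hstep : ∀ i : Fin n, D i.succ ≤ D i.castSucc ∧ (D i.succ = D i.castSucc → σ i = τ i) := by
    intro i
    have := sum_sq_sub_comp_perm (hσ i ▸ hX.strictMono i.succ) (hτ i ▸ hY.strictMono i.succ)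
    simp only [hD, hσ i, hτ i]
    simpa using this
  have hanti : Antitone D := Fin.antitone_iff_succ_le.2 fun i => (hstep i).1
  have hlast : D (Fin.last n) = D 0 := by simp [hD, hX.last, hY.last]
  have heq := (hstep i).2 (le_antisymm (hstep i).1
    ((hanti (Fin.zero_le _)).trans (hlast ▸ hanti (Fin.le_last _))))
  exact ⟨σ i, hσ i, heq ▸ hτ i⟩

/-- Adding `m` at a common position changes neither the residues of `X` mod `m` nor `X - Y`, so the
common sorting permutations carry both along. -/
theorem exists_perm_sub (hX : IsSortedOrbit m n c X) (hY : IsSortedOrbit m n c Y)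
    (i : Fin (n + 1)) : ∃ π : Equiv.Perm (Fin m), ∀ k,
      (X i k : ZMod m) = X 0 (π k) ∧ X i k - Y i k = X 0 (π k) - Y 0 (π k) := by
  induction i using Fin.induction with
  | zero => exact ⟨1, fun k => ⟨rfl, rfl⟩⟩
  | succ i ih =>
    obtain ⟨π, hπ⟩ := ih
    obtain ⟨σ, h1, h2⟩ := hX.exists_common_perm hY i
    refine ⟨σ.trans π, fun k => ?_⟩
    rw [h1, h2, Equiv.trans_apply, ← (hπ (σ k)).1, ← (hπ (σ k)).2]
    refine ⟨?_, by simp⟩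
    rcases eq_or_ne (σ k) (c i) with h | h <;> simp [h]

/-- Two orbits with the same word differ by a constant. -/
theorem sub_eq_sub (hmn : Nat.Coprime m n) (hX : IsSortedOrbit m n c X)
    (hY : IsSortedOrbit m n c Y) (hinj : Function.Injective fun k => (X 0 k : ZMod m))
    (a b : Fin m) : X 0 a - Y 0 a = X 0 b - Y 0 b := by
  obtain ⟨π, hπ⟩ := hX.exists_perm_sub hY (Fin.last n)
  have h1 : ∀ k, (X 0 (π k) : ZMod m) = X 0 k + n := fun k => by
    rw [← (hπ k).1, hX.last]
    push_cast
    rfl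
  have h2 : ∀ k, X 0 (π k) - Y 0 (π k) = X 0 k - Y 0 k := fun k => by
    rw [← (hπ k).2, hX.last, hY.last]
    ring
  have h3 : ∀ r : ℕ, (X 0 (π^[r] a) : ZMod m) = X 0 a + r * n ∧
      X 0 (π^[r] a) - Y 0 (π^[r] a) = X 0 a - Y 0 a := by
    intro r
    induction r with
    | zero => simp
    | succ r ih =>
      rw [Function.iterate_succ_apply', h1, h2, ih.1, ih.2]
      refine ⟨?_, rfl⟩
      push_cast
      ring
  have : NeZero m := ⟨a.pos.ne'⟩
  -- Over the whole run `π` adds `n` to residues and preserves `X 0 - Y 0`. This number of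
  -- iterations takes the residue of `a` to that of `b`.
  have h4 := h3 (((X 0 b : ZMod m) - X 0 a) * (n : ZMod m)⁻¹).val
  rw [ZMod.natCast_zmod_val] at h4
  have hinv := ZMod.coe_mul_inv_eq_one n hmn.symm
  have h5 : (X 0 (π^[(((X 0 b : ZMod m) - X 0 a) * (n : ZMod m)⁻¹).val] a) : ZMod m) = X 0 b := by
    rw [h4.1]
    linear_combination ((X 0 b : ZMod m) - X 0 a) * hinv
  rw [← h4.2, hinj h5]

end IsSortedOrbit

/-! ### Bijectivity of `B` and of zeta. -/

theorem mapB_mapsTo (hm : 0 < m) (hmn : Nat.Coprime m n) :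
    Set.MapsTo mapB (parkingTuples m n) (parkingWords m n) := by
  intro P _
  obtain ⟨c, X, -, hB, hX⟩ := P.exists_isSortedOrbit hm hmn
  rw [mem_parkingWords_iff hm]
  simp only [hB]
  exact ⟨fun j => (c j).2, fun i _ hi => hX.mul_le_card_mul hi⟩

theorem mapB_injOn (hm : 0 < m) (hmn : Nat.Coprime m n) :
    Set.InjOn mapB (parkingTuples m n) := by
  intro P hP Q hQ h
  obtain ⟨c, X, hXr, hXB, hX⟩ := P.exists_isSortedOrbit hm hmn
  obtain ⟨c', Y, hYr, hYB, hY⟩ := Q.exists_isSortedOrbit hm hmn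
  obtain rfl : c = c' := funext fun i => Fin.ext (by rw [← hXB, ← hYB, h])
  -- The Dyck condition fixes the smallest entry, so the constant difference of the two orbits is
  -- zero.
  have hzero : ∀ {P : FilterTuple m n} {X : Fin (n + 1) → Fin m → ℤ}, P ∈ parkingTuples m n →
      (∀ i, Set.range (X i) = (P.filt i).mSet) → StrictMono (X 0) → X 0 ⟨0, hm⟩ = 0 := by
    intro P X hP hr hs
    have h0 : (0 : ℤ) ∈ (P.filt 0).mSet := (mem_mSet hm).2
      ⟨hP.1, fun hc => by have := zero_le_of_mem_levels hP hc; omega⟩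
    rw [← hr] at h0
    obtain ⟨k, hk⟩ := h0
    have h1 : X 0 ⟨0, hm⟩ ≤ X 0 k := hs.monotone (Fin.le_def.2 (Nat.zero_le _))
    have h2 : X 0 ⟨0, hm⟩ ∈ (P.filt 0).mSet := hr 0 ▸ Set.mem_range_self _
    have h3 := zero_le_of_mem_levels hP ((mem_mSet hm).1 h2).1
    omega
  have hXY : X 0 = Y 0 := by
    funext k
    have h1 := hX.sub_eq_sub hmn hY
      (intCast_injective_of_range_eq hm hmn (hX.strictMono 0) (hXr 0)) k ⟨0, hm⟩
    rw [hzero hP hXr (hX.strictMono 0), hzero hQ hYr (hY.strictMono 0)] at h1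
    linarith
  have hall : ∀ i, X i = Y i := by
    intro i
    induction i using Fin.induction with
    | zero => exact hXY
    | succ i ih =>
      obtain ⟨σ, h1, h2⟩ := hX.exists_common_perm hY i
      rw [h1, h2, ih]
  apply FilterTuple.ext
  funext i
  apply mSet_injective hm hmn
  rw [← hXr, ← hYr, hall]

/-- `A` shows that there are as many parking tuples as parking words, a finite number, so
injectivity of `B` suffices. -/
theorem mapB_bijOn (hm : 0 < m) (hn : 0 < n) (hmn : Nat.Coprime m n) :
    Set.BijOn mapB (parkingTuples m n) (parkingWords m n) := by
  refine ⟨mapB_mapsTo hm hmn, mapB_injOn hm hmn, ?_⟩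
  have hA := mapA_bijOn hm hn hmn
  have hcard : (mapB '' parkingTuples m n).ncard = (parkingWords m n).ncard := by
    rw [(mapB_injOn hm hmn).ncard_image, ← hA.image_eq,
      hA.injOn.ncard_image]
  exact (Set.eq_of_subset_of_ncard_le (mapB_mapsTo hm hmn).image_subset hcard.ge
    (finite_parkingWords m n)).ge

theorem zeta_mapA (hm : 0 < m) (hn : 0 < n) (hmn : Nat.Coprime m n) {P : FilterTuple m n}
    (hP : P ∈ parkingTuples m n) : zeta m n (mapA P) = mapB P := by
  have hex : ∃ Q ∈ parkingTuples m n, mapA Q = mapA P := ⟨P, hP, rfl⟩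
  rw [zeta, dif_pos hex]
  exact congrArg mapB (mapA_injOn hm hn hmn hex.choose_spec.1 hP hex.choose_spec.2)

theorem zeta_bijOn (hm : 0 < m) (hn : 0 < n) (hmn : Nat.Coprime m n) :
    Set.BijOn (zeta m n) (parkingWords m n) (parkingWords m n) := by
  have hcomp : Set.BijOn (zeta m n ∘ mapA) (parkingTuples m n) (parkingWords m n) :=
    (mapB_bijOn hm hn hmn).congr fun P hP => (zeta_mapA hm hn hmn hP).symm
  rwa [Set.bijOn_comp_iff (mapA_injOn hm hn hmn), (mapA_bijOn hm hn hmn).image_eq] at hcomp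

end RationalZeta

theorem mainTheorem2 (m n : ℕ) (hm : 0 < m) (hn : 0 < n) (hmn : Nat.Coprime m n) :
    Set.BijOn RationalZeta.mapB (RationalZeta.parkingTuples m n) (RationalZeta.parkingWords m n) ∧
    Set.BijOn RationalZeta.mapA (RationalZeta.parkingTuples m n) (RationalZeta.parkingWords m n) ∧
    Set.BijOn (RationalZeta.zeta m n) (RationalZeta.parkingWords m n)
      (RationalZeta.parkingWords m n) :=
  ⟨RationalZeta.mapB_bijOn hm hn hmn, RationalZeta.mapA_bijOn hm hn hmn,
    RationalZeta.zeta_bijOn hm hn hmn⟩
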